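/- Let $G$ be a connected (finite-dimensional, real, smooth) Lie group with unit $e$, Lie algebra $\mathfrak g=T_eG$ (with the bracket of left-invariant vector fields) and dual $\mathfrak g^*=T_e^*G$. Let $l_g$ be the left translation by $g$, let $\operatorname{Ad}g:\mathfrak g\to\mathfrak g$ be the differential at $e$ of $x\mapsto gxg^{-1}$, and let $(\operatorname{Ad}^*g\,\xi)(v)=\xi((\operatorname{Ad}g)^{-1}v)$ for $\xi\in\mathfrak g^*$, $v\in\mathfrak g$. Each fibre $T_g^*G$ is identified with $\mathfrak g^*$ by left translation: $\eta\in T_g^*G$ corresponds to $\xi\in\mathfrak g^*$, $\xi(w)=\eta(dl_g(w))$. For $u\in\mathfrak g$, the invariant Hamiltonian vector field $U$ on $T^*G$ defined by $u$ is $U(g,\xi)=(dl_g(u),\,\xi([u,\cdot]))$. A section $g\mapsto\xi(g)$ of $T^*G\to G$ is called a solution of the left-invariant Hamiltonian system $\dot g=dl_g(u)$, $\dot\xi(w)=\xi([u,w])$ if it is differentiable and, for all $g\in G$ and $u,w\in\mathfrak g$, the derivative of the function $\xi(\cdot)(w)$ at $g$ in the direction $dl_g(u)$ equals $\xi(g)([u,w])$.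 For $\xi_0\in\mathfrak g^*$ let $s_{\xi_0}$ be the section $s_{\xi_0}(g)=(\operatorname{Ad}^*g)^{-1}\xi_0\in T_g^*G$. 1. For every $\xi_0\in T_e^*G$ the section $s_{\xi_0}$ is smooth, has the value $\xi_0$ at $e$, and is a solution of the Hamiltonian system; every solution with value $\xi_0$ at $e$ is equal to $s_{\xi_0}$. 2. The map $(g,\xi)\mapsto s_\xi(g)$ is a diffeomorphism $G\times\mathfrak g^*\to T^*G$. Call leaves the maximal connected integral manifolds of the distribution on $T^*G$ spanned by the invariant Hamiltonian vector fields. The leaves are exactly the images $s_{\xi_0}(G)$, $\xi_0\in\mathfrak g^*$, and every point of $T^*G$ lies on exactly one leaf. Read in $\mathfrak g^*$ through left translation, the leaf $s_{\xi_0}(G)$ through $\xi_0$ is the coadjoint orbit $\{\operatorname{Ad}^*g\,\xi_0: g\in G\}$. The foliation is invariant: for $h\in G$ the lift $(g,\eta)\mapsto(hg,\ \eta\circ(d(l_h)_g)^{-1})$ of $l_h$ to $T^*G$ maps the leaf $s_{\xi_0}(G)$ onto the leaf $s_{\operatorname{Ad}^*h\,\xi_0}(G)$. -/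

import Mathlib

open Set Bundle
open scoped Manifold ContDiff Topology

universe u

noncomputable section

namespace LieCotangent

/-- The cotangent space `T_g^* M` of an `n`-manifold. -/
abbrev CotangentSpace (n : ℕ) {M : Type*} [TopologicalSpace M]
    [ChartedSpace (EuclideanSpace ℝ (Fin n)) M] (g : M) : Type :=
  TangentSpace (𝓡 n) g →L[ℝ] ℝ

/-- The cotangent bundle `T^* M` of an `n`-manifold, with Mathlib's topology and smooth structure
on bundles of continuous linear maps. -/
abbrev Cotangent (n : ℕ) (M : Type*) [TopologicalSpace M]
    [ChartedSpace (EuclideanSpace ℝ (Fin n)) M] : Type _ :=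
  TotalSpace (EuclideanSpace ℝ (Fin n) →L[ℝ] ℝ) (fun g : M => CotangentSpace n g)

/-- The model with corners of the manifold `T^* M`. -/
abbrev cotangentModel (n : ℕ) :=
  (𝓡 n).prod 𝓘(ℝ, EuclideanSpace ℝ (Fin n) →L[ℝ] ℝ)

/-- The map `M → T^* M` underlying a family of covectors `σ g ∈ T_g^* M`. -/
def toBundle {n : ℕ} {M : Type*} [TopologicalSpace M]
    [ChartedSpace (EuclideanSpace ℝ (Fin n)) M] (σ : ∀ g : M, CotangentSpace n g) :
    M → Cotangent n M :=
  fun g => ⟨g, σ g⟩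

variable {n : ℕ} {G : Type u} [TopologicalSpace G] [ChartedSpace (EuclideanSpace ℝ (Fin n)) G]
  [Group G]

section translations

variable [LieGroup (𝓡 n) ∞ G]

theorem mdifferentiableAt_mul_left (g h : G) :
    MDifferentiableAt (𝓡 n) (𝓡 n) (fun x : G => g * x) h :=
  ((contMDiff_mul_left (I := 𝓡 n) (n := ∞) (a := g)).contMDiffAt).mdifferentiableAt (by simp)

theorem mdifferentiableAt_conj (g h : G) :
    MDifferentiableAt (𝓡 n) (𝓡 n) (fun x : G => g * x * g⁻¹) h :=
  (((contMDiff_mul_right (I := 𝓡 n) (n := ∞) (a := g⁻¹)).comp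
    (contMDiff_mul_left (I := 𝓡 n) (n := ∞) (a := g))).contMDiffAt).mdifferentiableAt (by simp)

theorem mfderiv_mul_left_comp (g h k : G) (hk : g * h = k) :
    (mfderiv (𝓡 n) (𝓡 n) (fun x : G => g⁻¹ * x) k :
        EuclideanSpace ℝ (Fin n) →L[ℝ] EuclideanSpace ℝ (Fin n)).comp
      (mfderiv (𝓡 n) (𝓡 n) (fun x : G => g * x) h) = ContinuousLinearMap.id ℝ _ := by
  subst hk
  have h₁ := mfderiv_comp (I := 𝓡 n) (I' := 𝓡 n) (I'' := 𝓡 n) h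
    (mdifferentiableAt_mul_left (n := n) g⁻¹ (g * h)) (mdifferentiableAt_mul_left (n := n) g h)
  have h₂ : (fun x : G => g⁻¹ * x) ∘ (fun x : G => g * x) = id := by ext x; simp
  rw [h₂, mfderiv_id] at h₁
  exact h₁.symm

theorem mfderiv_conj_comp (g : G) :
    (mfderiv (𝓡 n) (𝓡 n) (fun x : G => g⁻¹ * x * g⁻¹⁻¹) 1 :
        EuclideanSpace ℝ (Fin n) →L[ℝ] EuclideanSpace ℝ (Fin n)).comp
      (mfderiv (𝓡 n) (𝓡 n) (fun x : G => g * x * g⁻¹) 1) = ContinuousLinearMap.id ℝ _ := by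
  have h₀ : g * 1 * g⁻¹ = 1 := by simp
  have h₁ := mfderiv_comp (I := 𝓡 n) (I' := 𝓡 n) (I'' := 𝓡 n) 1
    (mdifferentiableAt_conj (n := n) g⁻¹ (g * 1 * g⁻¹)) (mdifferentiableAt_conj (n := n) g 1)
  have h₂ : (fun x : G => g⁻¹ * x * g⁻¹⁻¹) ∘ (fun x : G => g * x * g⁻¹) = id := by
    ext x; simp [mul_assoc]
  rw [h₂, mfderiv_id, h₀] at h₁
  exact h₁.symm

/-- The differential `dl_g : 𝔤 = T_e G → T_g G` at `e` of the left translation `l_g`. -/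
def dl (g : G) : GroupLieAlgebra (𝓡 n) G ≃L[ℝ] TangentSpace (𝓡 n) g :=
  ContinuousLinearEquiv.equivOfInverse
    (M₁ := GroupLieAlgebra (𝓡 n) G) (M₂ := TangentSpace (𝓡 n) g)
    (mfderiv (𝓡 n) (𝓡 n) (fun x : G => g * x) 1)
    (mfderiv (𝓡 n) (𝓡 n) (fun x : G => g⁻¹ * x) g)
    (fun v => DFunLike.congr_fun (mfderiv_mul_left_comp g 1 g (mul_one g)) v)
    (fun v => by
      have h := mfderiv_mul_left_comp (n := n) g⁻¹ g 1 (inv_mul_cancel g)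
      rw [inv_inv] at h
      exact DFunLike.congr_fun h v)

/-- The adjoint representation `Ad g = d(I(g))_e : 𝔤 → 𝔤`, with `I(g)(x) = g x g⁻¹`. -/
def Ad (g : G) : GroupLieAlgebra (𝓡 n) G ≃L[ℝ] GroupLieAlgebra (𝓡 n) G :=
  ContinuousLinearEquiv.equivOfInverse
    (M₁ := GroupLieAlgebra (𝓡 n) G) (M₂ := GroupLieAlgebra (𝓡 n) G)
    (mfderiv (𝓡 n) (𝓡 n) (fun x : G => g * x * g⁻¹) 1)
    (mfderiv (𝓡 n) (𝓡 n) (fun x : G => g⁻¹ * x * g⁻¹⁻¹) 1)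
    (fun v => DFunLike.congr_fun (mfderiv_conj_comp g) v)
    (fun v => by
      have h := mfderiv_conj_comp (n := n) g⁻¹
      rw [inv_inv g] at h
      rw [inv_inv g]
      exact DFunLike.congr_fun h v)

/-- `Ad^* g : 𝔤^* → 𝔤^*`, `(Ad^* g ξ)(v) = ξ((Ad g)⁻¹ v)`, where `𝔤^* = T_e^* G`. -/
def coAd (g : G) : CotangentSpace n (1 : G) ≃ CotangentSpace n (1 : G) where
  toFun ξ := ξ.comp (Ad (n := n) g).symm.toContinuousLinearMap
  invFun ξ := ξ.comp (Ad (n := n) g).toContinuousLinearMap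
  left_inv ξ := by ext v; simp
  right_inv ξ := by ext v; simp

/-- The orbit of `ξ₀ ∈ 𝔤^*` under the coadjoint action of `G`. -/
def coadjointOrbit (ξ₀ : CotangentSpace n (1 : G)) : Set (CotangentSpace n (1 : G)) :=
  Set.range fun g : G => coAd g ξ₀

/-- The identification of `𝔤^*` with `T_g^* G` through left translation: `ξ ∈ 𝔤^*` goes to the
value at `g` of the left-invariant 1-form with value `ξ` at `e`. -/
def leftForm (g : G) (ξ : CotangentSpace n (1 : G)) : CotangentSpace n g :=
  ξ.comp (dl (n := n) g).symm.toContinuousLinearMap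

/-- The inverse identification: a covector `p = (g, η)` of `T^* G` is read as the element
`w ↦ η (dl_g w)` of `𝔤^*`. -/
def toDual (p : Cotangent n G) : CotangentSpace n (1 : G) :=
  p.2.comp (dl (n := n) p.1).toContinuousLinearMap

/-- The section `g ↦ (Ad^* g)⁻¹ ξ₀ ∈ T_g^* G` of `T^* G → G`. -/
def coadjointSection (ξ₀ : CotangentSpace n (1 : G)) (g : G) : CotangentSpace n g :=
  leftForm g ((coAd g).symm ξ₀)

/-- A section `σ` of `T^* G → G` solves the left-invariant Hamiltonian system
`ġ = dl_g u`, `ξ̇(w) = ξ([u, w])`: it is differentiable as a map `G → T^* G`, and for all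
`u, w ∈ 𝔤` the derivative of `ξ(w)`, with `ξ(g) ∈ 𝔤^*` the covector `σ g` read through left
translation, in the direction `dl_g u` is `ξ([u, w])`. -/
def IsSolution (σ : ∀ g : G, CotangentSpace n g) : Prop :=
  MDifferentiable (𝓡 n) (cotangentModel n) (toBundle σ) ∧
    ∀ (g : G) (u w : GroupLieAlgebra (𝓡 n) G),
      mfderiv (𝓡 n) 𝓘(ℝ, ℝ) (fun x : G => toDual (toBundle σ x) w) g (dl g u) =
        toDual (toBundle σ g) ⁅u, w⁆

/-- `Λ ∈ T_p(T^* G)` is the value at `p` of the invariant Hamiltonian vector field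
`U(g, ξ) = (dl_g u, ξ([u, ·]))` on `T^* G` defined by `u ∈ 𝔤`: its projection to `G` is `dl_g u`,
and for each `w ∈ 𝔤` the derivative along `Λ` of the function `p ↦ ξ(w)`, with `ξ ∈ 𝔤^*`
the covector `p` read through left translation, is `ξ([u, w])`. -/
def IsHamiltonianVector (u : GroupLieAlgebra (𝓡 n) G) (p : Cotangent n G)
    (Λ : TangentSpace (cotangentModel n) p) : Prop :=
  mfderiv (cotangentModel n) (𝓡 n) (fun q : Cotangent n G => q.1) p Λ = dl p.1 u ∧
    ∀ w : GroupLieAlgebra (𝓡 n) G,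
      mfderiv (cotangentModel n) 𝓘(ℝ, ℝ) (fun q : Cotangent n G => toDual q w) p Λ =
        toDual p ⁅u, w⁆

/-- The values at `p` of all invariant Hamiltonian vector fields. -/
def hamiltonianDistribution (p : Cotangent n G) : Set (TangentSpace (cotangentModel n) p) :=
  {Λ | ∃ u : GroupLieAlgebra (𝓡 n) G, IsHamiltonianVector u p Λ}

/-- `L ⊆ T^* G` is a connected integral manifold of the distribution spanned by the invariant
Hamiltonian vector fields: the image of a connected smooth manifold under an injective immersion
whose tangent space at every point is the distribution. -/
def IsIntegralManifold (L : Set (Cotangent n G)) : Prop :=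
  ∃ (N : Type u) (_ : TopologicalSpace N) (_ : ChartedSpace (EuclideanSpace ℝ (Fin n)) N)
    (f : N → Cotangent n G),
    IsManifold (𝓡 n) ∞ N ∧ ConnectedSpace N ∧ Function.Injective f ∧
    ContMDiff (𝓡 n) (cotangentModel n) ∞ f ∧
    (∀ x, Function.Injective (mfderiv (𝓡 n) (cotangentModel n) f x)) ∧
    (∀ x, Set.range (mfderiv (𝓡 n) (cotangentModel n) f x) = hamiltonianDistribution (f x)) ∧
    Set.range f = L

/-- A leaf of the invariant foliation of `T^* G`: a maximal connected integral manifold of the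
distribution spanned by the invariant Hamiltonian vector fields. -/
def IsLeaf (L : Set (Cotangent n G)) : Prop :=
  IsIntegralManifold L ∧
    ∀ L' : Set (Cotangent n G), IsIntegralManifold L' → (L ∩ L').Nonempty → L' ⊆ L

/-- The lift to `T^* G` of the left translation `l_h`: `(g, η) ↦ (h g, η ∘ (d(l_h)_g)⁻¹)`. -/
def leftLift (h : G) (p : Cotangent n G) : Cotangent n G :=
  ⟨h * p.1, p.2.comp (mfderiv (𝓡 n) (𝓡 n) (fun x : G => h * x) p.1).inverse⟩

end translations

end LieCotangent

end

/-! Everything rests on the moment map J(g, ξ) = Ad^*g ξ (`momentMap`), with ξ ∈ 𝔤^* the left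
reading of the covector. Since s_{ξ₀}(g) is the only covector over g with J = ξ₀, the pair
(projection, J) inverts (g, ξ) ↦ s_ξ(g), and the images of the sections are the level sets of J.

The analytic input is `modelDeriv_adVec`: the derivative of g ↦ Ad g w along dl_g u is Ad g [u, w].
By Ad(gh) = Ad g Ad h it reduces to g = e. There one differentiates d(r_g)(Ad g w) = d(l_g) w in the
chart at e, with r_g the right translation; symmetry of the second derivative of the multiplication
turns the result into the bracket.

This formula shows both that s_{ξ₀} is a solution and that dJ kills the distribution
(`mfderiv_momentMap_eq_zero`). Hence J is constant on connected manifolds tangent to the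
distribution (`momentMap_apply_eq`). Uniqueness of solutions follows, and each connected integral
manifold lies in one level set of J; the level sets are themselves integral manifolds, so they are
the leaves. Invariance is the equivariance J(h·p) = Ad^*h J(p). -/

noncomputable section

namespace LieCotangent

/-! ### Derivatives and covectors in tangent coordinates -/

section tangent

variable {n : ℕ} {M : Type*} [TopologicalSpace M] [ChartedSpace (EuclideanSpace ℝ (Fin n)) M]
  {M' : Type*} [TopologicalSpace M'] [ChartedSpace (EuclideanSpace ℝ (Fin n)) M']

/-- The derivative of a map between `n`-manifolds, as an endomorphism of the model space. -/
def modelDeriv (n : ℕ) {M : Type*} [TopologicalSpace M] [ChartedSpace (EuclideanSpace ℝ (Fin n)) M]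
    {M' : Type*} [TopologicalSpace M'] [ChartedSpace (EuclideanSpace ℝ (Fin n)) M'] (f : M → M')
    (x : M) : EuclideanSpace ℝ (Fin n) →L[ℝ] EuclideanSpace ℝ (Fin n) :=
  mfderiv (𝓡 n) (𝓡 n) f x

/-- The change of coordinates of the tangent bundle at `x`, from the chart at `y` to the chart
at `z`. -/
def tangentChange (n : ℕ) {M : Type*} [TopologicalSpace M]
    [ChartedSpace (EuclideanSpace ℝ (Fin n)) M] [IsManifold (𝓡 n) 1 M] (y z x : M) :
    EuclideanSpace ℝ (Fin n) →L[ℝ] EuclideanSpace ℝ (Fin n) :=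
  (tangentBundleCore (𝓡 n) M).coordChange (achart _ y) (achart _ z) x

theorem tangentChange_self [IsManifold (𝓡 n) 1 M] (x : M) :
    tangentChange n x x x = ContinuousLinearMap.id ℝ _ := by
  ext1 v
  exact (tangentBundleCore (𝓡 n) M).coordChange_self _ _ (mem_chart_source _ x) v

theorem tangentChange_comp_tangentChange [IsManifold (𝓡 n) 1 M] {x y : M}
    (hx : x ∈ (chartAt (EuclideanSpace ℝ (Fin n)) y).source) :
    (tangentChange n y x x).comp (tangentChange n x y x) = ContinuousLinearMap.id ℝ _ := by
  ext1 v
  refine ((tangentBundleCore (𝓡 n) M).coordChange_comp (achart _ x) (achart _ y) (achart _ x) x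
    ⟨⟨mem_chart_source _ x, hx⟩, mem_chart_source _ x⟩ v).trans ?_
  exact (tangentBundleCore (𝓡 n) M).coordChange_self _ _ (mem_chart_source _ x) v

/-- Near `x₀` the derivative in tangent coordinates is the plain derivative framed by two coordinate
changes. The separate name `b x` for `f x (g x)` keeps the target base point in simplified form (`1`
or `g`), so that a change at a constant base point becomes the identity. -/
theorem contMDiffAt_modelDeriv [IsManifold (𝓡 n) 1 M] [IsManifold (𝓡 n) 1 M']
    {E : Type*} [NormedAddCommGroup E] [NormedSpace ℝ E] {H : Type*} [TopologicalSpace H]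
    {J : ModelWithCorners ℝ E H} {N : Type*} [TopologicalSpace N] [ChartedSpace H N]
    [IsManifold J 1 N] {f : N → M → M'} {g : N → M} {b : N → M'} {x₀ : N}
    (hf : ContMDiffAt (J.prod (𝓡 n)) (𝓡 n) ∞ (Function.uncurry f) (x₀, g x₀))
    (hg : ContMDiffAt J (𝓡 n) ∞ g x₀) (hb : ∀ x, f x (g x) = b x) :
    ContMDiffAt J 𝓘(ℝ, EuclideanSpace ℝ (Fin n) →L[ℝ] EuclideanSpace ℝ (Fin n)) ∞
      (fun x => (tangentChange n (b x) (b x₀) (b x)).comp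
        ((modelDeriv n (f x) (g x)).comp (tangentChange n (g x₀) (g x) (g x)))) x₀ := by
  have h := ContMDiffAt.mfderiv (J := J) (I := 𝓡 n) (I' := 𝓡 n) (m := ∞) (n := ∞) (x₀ := x₀)
    f g hf hg (by simp)
  refine h.congr_of_eventuallyEq ?_
  have hc : ContinuousAt (fun x => f x (g x)) x₀ :=
    ContMDiffAt.continuousAt (ContMDiffAt.comp (g := Function.uncurry f) x₀ hf
      (contMDiffAt_id.prodMk hg))
  filter_upwards [hg.continuousAt.eventually
      ((chartAt (EuclideanSpace ℝ (Fin n)) (g x₀)).open_source.mem_nhds (mem_chart_source _ _)),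
    hc.eventually ((chartAt (EuclideanSpace ℝ (Fin n)) _).open_source.mem_nhds
      (mem_chart_source _ _))] with x hx hx'
  refine Eq.trans ?_ (inTangentCoordinates_eq (I := 𝓡 n) (I' := 𝓡 n) g (fun x => f x (g x))
    (fun x => modelDeriv n (f x) (g x)) hx hx').symm
  rw [hb, hb]
  rfl

/-- In the bundle `T^* M`, reading covectors in the canonical trivialization at a point. -/
theorem inCoordinates_cotangent_apply [IsManifold (𝓡 n) 1 M] {x₀ x : M}
    (hx : x ∈ (chartAt (EuclideanSpace ℝ (Fin n)) x₀).source) (η : CotangentSpace n x)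
    (v : EuclideanSpace ℝ (Fin n)) :
    ContinuousLinearMap.inCoordinates (EuclideanSpace ℝ (Fin n)) (TangentSpace (𝓡 n)) ℝ
      (fun _ : M => ℝ) x₀ x x₀ x η v = η (tangentChange n x₀ x x v) := by
  have h : ContinuousLinearMap.inCoordinates (EuclideanSpace ℝ (Fin n)) (TangentSpace (𝓡 n)) ℝ
      (fun _ : M => ℝ) x₀ x x₀ x η v =
      η ((trivializationAt (EuclideanSpace ℝ (Fin n)) (TangentSpace (𝓡 n)) x₀).symmL ℝ x v) := by
    simp [ContinuousLinearMap.inCoordinates]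
  exact h.trans
    (congrArg η (DFunLike.congr_fun (TangentBundle.symmL_trivializationAt_eq_core hx) v))

end tangent

/-! ### Smoothness of Ad and of the left trivialization of T^*G -/

variable {n : ℕ} {G : Type u} [TopologicalSpace G] [ChartedSpace (EuclideanSpace ℝ (Fin n)) G]
  [Group G] [LieGroup (𝓡 n) ∞ G]

/-- The adjoint representation is smooth. -/
theorem contMDiff_Ad :
    ContMDiff (𝓡 n) 𝓘(ℝ, EuclideanSpace ℝ (Fin n) →L[ℝ] EuclideanSpace ℝ (Fin n))
    (M' := EuclideanSpace ℝ (Fin n) →L[ℝ] EuclideanSpace ℝ (Fin n)) ∞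
    (fun g : G => (Ad (n := n) g).toContinuousLinearMap) := by
  have : IsManifold (𝓡 n) 1 G := IsManifold.of_le (n := ∞) (by simp)
  intro g₀
  have h := contMDiffAt_modelDeriv (J := 𝓡 n) (x₀ := g₀)
    (n := n) (f := fun g x : G => g * x * g⁻¹) (g := fun _ : G => (1 : G)) (b := fun _ => 1)
    (((contMDiff_fst.mul contMDiff_snd).mul contMDiff_fst.inv).contMDiffAt)
    contMDiffAt_const (by simp)
  simp only [tangentChange_self, ContinuousLinearMap.id_comp, ContinuousLinearMap.comp_id] at h
  exact h

/-- In the trivialization at `p₀.1` the pullback η ∘ dl_g is the coordinate form of η composed with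
that of dl_g; both factors are smooth, and the two coordinate changes between them cancel. -/
theorem contMDiff_toDual : ContMDiff (cotangentModel n) 𝓘(ℝ, EuclideanSpace ℝ (Fin n) →L[ℝ] ℝ)
    (M' := EuclideanSpace ℝ (Fin n) →L[ℝ] ℝ) ∞ (fun p : Cotangent n G => toDual p) := by
  have : IsManifold (𝓡 n) 1 G := IsManifold.of_le (n := ∞) (by simp)
  intro p₀
  have h := contMDiffAt_modelDeriv (J := 𝓡 n) (x₀ := p₀.1)
    (n := n) (f := fun g x : G => g * x) (g := fun _ : G => (1 : G)) (b := fun g => g)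
    ((contMDiff_mul (𝓡 n) ∞ (G := G)).contMDiffAt) contMDiffAt_const (by simp)
  simp only [tangentChange_self, ContinuousLinearMap.comp_id] at h
  have hid : ContMDiffAt (cotangentModel n) (cotangentModel n) ∞ (fun p : Cotangent n G => p) p₀ :=
    contMDiffAt_id
  rw [contMDiffAt_hom_bundle] at hid
  refine (hid.2.clm_comp (h.comp p₀ hid.1)).congr_of_eventuallyEq ?_
  filter_upwards [hid.1.continuousAt.eventually
      ((chartAt (EuclideanSpace ℝ (Fin n)) p₀.1).open_source.mem_nhds (mem_chart_source _ _))]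
    with p hp
  refine ContinuousLinearMap.ext fun v => Eq.symm ?_
  refine (inCoordinates_cotangent_apply hp _ _).trans ?_
  exact congrArg p.2 (DFunLike.congr_fun (tangentChange_comp_tangentChange hp) _)

/-- The inverse of dl_g is the derivative at g of x ↦ g⁻¹x, whose target base point is always e;
only the change of coordinates at the source remains, and it is the one the trivialization of T^*G
supplies. -/
theorem contMDiff_leftForm : ContMDiff ((𝓡 n).prod 𝓘(ℝ, EuclideanSpace ℝ (Fin n) →L[ℝ] ℝ))
    (cotangentModel n) ∞ (fun q : G × (EuclideanSpace ℝ (Fin n) →L[ℝ] ℝ) =>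
      (⟨q.1, leftForm q.1 q.2⟩ : Cotangent n G)) := by
  have : IsManifold (𝓡 n) 1 G := IsManifold.of_le (n := ∞) (by simp)
  intro q₀
  rw [contMDiffAt_hom_bundle]
  refine ⟨contMDiffAt_fst, ?_⟩
  have h := contMDiffAt_modelDeriv (J := 𝓡 n) (x₀ := q₀.1)
    (n := n) (f := fun g x : G => g⁻¹ * x) (g := fun g : G => g) (b := fun _ => 1)
    ((contMDiff_fst.inv.mul contMDiff_snd).contMDiffAt) contMDiffAt_id (by simp)
  simp only [tangentChange_self, ContinuousLinearMap.id_comp] at h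
  refine ((contMDiffAt_snd (I := 𝓡 n) (J := 𝓘(ℝ, EuclideanSpace ℝ (Fin n) →L[ℝ] ℝ)) (p := q₀)
    (n := ∞)).clm_comp (h.comp q₀ contMDiffAt_fst)).congr_of_eventuallyEq ?_
  filter_upwards [continuousAt_fst.eventually
      ((chartAt (EuclideanSpace ℝ (Fin n)) q₀.1).open_source.mem_nhds (mem_chart_source _ _))]
    with p hp
  exact ContinuousLinearMap.ext fun v => inCoordinates_cotangent_apply hp _ _

/-! ### The bracket from second derivatives of a local multiplication -/

section calculus

variable {E : Type*} [NormedAddCommGroup E] [NormedSpace ℝ E]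

/-- If a `C^2` map `m` near `(e, e)` has the partial derivatives `id` at `(e, e)`, and `A`
intertwines its two partial derivatives, `∂₁m(e, a)(A a) = ∂₂m(a, e) w`, then the derivative of `A`
at `e` is given by the bracket of the fields `a ↦ ∂₂m(a, e) v`. -/
theorem fderiv_eq_lieBracket_of_partial {m : E × E → E} {e u w : E} {A : E → E}
    (hm : ContDiffAt ℝ 2 m (e, e))
    (h₁ : fderiv ℝ (fun b => m (b, e)) e = ContinuousLinearMap.id ℝ E)
    (h₂ : fderiv ℝ (fun b => m (e, b)) e = ContinuousLinearMap.id ℝ E)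
    (hA : DifferentiableAt ℝ A e) (hAe : A e = w)
    (h : ∀ᶠ a in 𝓝 e, fderiv ℝ (fun b => m (b, a)) e (A a) = fderiv ℝ (fun b => m (a, b)) e w) :
    fderiv ℝ A e u = VectorField.lieBracket ℝ (fun a => fderiv ℝ (fun b => m (a, b)) e u)
      (fun a => fderiv ℝ (fun b => m (a, b)) e w) e := by
  have hd : ∀ᶠ p in 𝓝 (e, e), DifferentiableAt ℝ m p := by
    filter_upwards [hm.eventually (by simp)] with p hp using hp.differentiableAt (by simp)
  have hl : ContinuousAt (fun a : E => (a, e)) e := by fun_prop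
  have hr : ContinuousAt (fun a : E => (e, a)) e := by fun_prop
  have e₂ : ∀ᶠ a in 𝓝 e, ∀ v, fderiv ℝ (fun b => m (a, b)) e v = fderiv ℝ m (a, e) (0, v) := by
    filter_upwards [hl.eventually hd] with a ha v
    have := ha.hasFDerivAt.comp e ((hasFDerivAt_const a e).prodMk (hasFDerivAt_id e))
    exact DFunLike.congr_fun this.fderiv v
  have e₁ : ∀ᶠ a in 𝓝 e, ∀ v, fderiv ℝ (fun b => m (b, a)) e v = fderiv ℝ m (e, a) (v, 0) := by
    filter_upwards [hr.eventually hd] with a ha v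
    have := HasFDerivAt.comp (f := fun b => (b, a)) e ha.hasFDerivAt
      ((hasFDerivAt_id e).prodMk (hasFDerivAt_const a e))
    exact DFunLike.congr_fun this.fderiv v
  have hf : HasFDerivAt (fderiv ℝ m) (fderiv ℝ (fderiv ℝ m) (e, e)) (e, e) :=
    ((hm.fderiv_right (m := 1) (by norm_num)).differentiableAt (by simp)).hasFDerivAt
  have hf₁ : HasFDerivAt (fun a => fderiv ℝ m (e, a)) _ e :=
    hf.comp e ((hasFDerivAt_const e e).prodMk (hasFDerivAt_id e))
  have hf₂ : HasFDerivAt (fun a => fderiv ℝ m (a, e)) _ e :=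
    HasFDerivAt.comp (f := fun b => (b, e)) e hf ((hasFDerivAt_id e).prodMk (hasFDerivAt_const e e))
  -- Differentiating `h` at `e` along `u` gives D²m(0,u)(w,0) + A'u = D²m(u,0)(0,w). `hQ` computes
  -- the right side and `hP` the left; in `hP` the term A'u appears bare because ∂₁m = id at (e, e).
  have hQ : ∀ v z, fderiv ℝ (fun a => fderiv ℝ (fun b => m (a, b)) e v) e z =
      fderiv ℝ (fderiv ℝ m) (e, e) (z, 0) (0, v) := by
    intro v z
    rw [Filter.EventuallyEq.fderiv_eq (e₂.mono fun a ha => ha v)]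
    rw [(hf₂.clm_apply (hasFDerivAt_const (0, v) e)).fderiv]
    simp
  have hP : ∀ z, fderiv ℝ (fun a => fderiv ℝ (fun b => m (b, a)) e (A a)) e z =
      fderiv ℝ (fderiv ℝ m) (e, e) (0, z) (w, 0) + fderiv ℝ A e z := by
    intro z
    rw [Filter.EventuallyEq.fderiv_eq (e₁.mono fun a ha => ha (A a))]
    have hAz : HasFDerivAt (fun a => (A a, (0 : E))) _ e :=
      hA.hasFDerivAt.prodMk (hasFDerivAt_const 0 e)
    rw [(hf₁.clm_apply hAz).fderiv]
    have := e₁.self_of_nhds (fderiv ℝ A e z)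
    rw [h₁] at this
    simp [hAe, ← this, add_comm]
  -- Symmetry turns D²m(0,u)(w,0) into D²m(w,0)(0,u), the second term of the bracket.
  have hs := (hm.isSymmSndFDerivAt (by simp)).eq (0, u) (w, 0)
  have hk := hP u
  rw [Filter.EventuallyEq.fderiv_eq h, hQ] at hk
  rw [VectorField.lieBracket, hQ, hQ, h₂]
  simp only [ContinuousLinearMap.id_apply]
  rw [hk, hs]
  abel

end calculus

/-! ### Chain rule and derivatives of charts -/

section bracket

variable {n : ℕ} {G : Type u} [TopologicalSpace G] [ChartedSpace (EuclideanSpace ℝ (Fin n)) G]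

/-- The intermediate point is a free `y` with `F x = y`, so that identities such as g · 1 = g
require no transport between tangent spaces. -/
theorem modelDeriv_comp {M₁ M₂ M₃ : Type*} [TopologicalSpace M₁]
    [ChartedSpace (EuclideanSpace ℝ (Fin n)) M₁] [TopologicalSpace M₂]
    [ChartedSpace (EuclideanSpace ℝ (Fin n)) M₂] [TopologicalSpace M₃]
    [ChartedSpace (EuclideanSpace ℝ (Fin n)) M₃] {F : M₁ → M₂} {H : M₂ → M₃} {x : M₁} {y : M₂}
    (hF : MDifferentiableAt (𝓡 n) (𝓡 n) F x)
    (hH : MDifferentiableAt (𝓡 n) (𝓡 n) H y) (h : F x = y) (v : EuclideanSpace ℝ (Fin n)) :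
    modelDeriv n (fun z => H (F z)) x v = modelDeriv n H y (modelDeriv n F x v) := by
  subst h
  exact DFunLike.congr_fun (mfderiv_comp (I := 𝓡 n) (I' := 𝓡 n) (I'' := 𝓡 n) x hH hF) v

/-- The derivative at `y` of the chart at `x`, as an endomorphism of the model space. -/
def chartDeriv (n : ℕ) {M : Type*} [TopologicalSpace M] [ChartedSpace (EuclideanSpace ℝ (Fin n)) M]
    (x y : M) : EuclideanSpace ℝ (Fin n) →L[ℝ] EuclideanSpace ℝ (Fin n) :=
  mfderiv (𝓡 n) 𝓘(ℝ, EuclideanSpace ℝ (Fin n)) (extChartAt (𝓡 n) x) y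

theorem chartDeriv_self [IsManifold (𝓡 n) 1 G] (x : G) :
    chartDeriv n x x = ContinuousLinearMap.id ℝ _ :=
  mfderiv_extChartAt_self (I := 𝓡 n) (x := x)

/-- This inverse is the factor by which a vector field is pulled back to the chart. -/
theorem mfderivWithin_extChartAt_symm_inverse [IsManifold (𝓡 n) 1 G] (x : G)
    {a : EuclideanSpace ℝ (Fin n)} (ha : a ∈ (extChartAt (𝓡 n) x).target) :
    (mfderivWithin 𝓘(ℝ, EuclideanSpace ℝ (Fin n)) (𝓡 n) (extChartAt (𝓡 n) x).symm (range (𝓡 n))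
      a).inverse = chartDeriv n x ((extChartAt (𝓡 n) x).symm a) :=
  ContinuousLinearMap.inverse_eq
    (mfderivWithin_extChartAt_symm_comp_mfderiv_extChartAt ha)
    (mfderiv_extChartAt_comp_mfderivWithin_extChartAt_symm ha)

/-- The derivative at the centre of a chart, in that chart, of a map between nearby points. -/
theorem hasFDerivAt_chart_conj [IsManifold (𝓡 n) 1 G] {F : G → G} {x y : G}
    (hF : MDifferentiableAt (𝓡 n) (𝓡 n) F x) (h : F x = y)
    (hy : y ∈ (chartAt (EuclideanSpace ℝ (Fin n)) x).source) :
    HasFDerivAt (fun b => extChartAt (𝓡 n) x (F ((extChartAt (𝓡 n) x).symm b)))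
      ((chartDeriv n x y).comp (modelDeriv n F x)) (extChartAt (𝓡 n) x x) := by
  subst h
  have h := (HasMFDerivAt.comp x (mdifferentiableAt_extChartAt (I := 𝓡 n) hy).hasMFDerivAt
    hF.hasMFDerivAt).2
  have h' : HasFDerivWithinAt (fun b => extChartAt (𝓡 n) x (F ((extChartAt (𝓡 n) x).symm b)))
      ((chartDeriv n x (F x)).comp (modelDeriv n F x)) (range (𝓡 n)) (extChartAt (𝓡 n) x x) := h
  rwa [ModelWithCorners.range_eq_univ, hasFDerivWithinAt_univ] at h'

end bracket

/-! ### The derivative of the adjoint representation -/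

section adjoint

variable {n : ℕ} {G : Type u} [TopologicalSpace G] [ChartedSpace (EuclideanSpace ℝ (Fin n)) G]
  [Group G]

/-- The multiplication of `G`, read in the chart at the unit. -/
def chartMul (n : ℕ) (G : Type u) [TopologicalSpace G] [ChartedSpace (EuclideanSpace ℝ (Fin n)) G]
    [Group G] (p : EuclideanSpace ℝ (Fin n) × EuclideanSpace ℝ (Fin n)) :
    EuclideanSpace ℝ (Fin n) :=
  extChartAt (𝓡 n) (1 : G) ((extChartAt (𝓡 n) (1 : G)).symm p.1 *
    (extChartAt (𝓡 n) (1 : G)).symm p.2)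

variable [LieGroup (𝓡 n) ∞ G]

theorem mdifferentiableAt_mul_right (g h : G) :
    MDifferentiableAt (𝓡 n) (𝓡 n) (fun x : G => x * g) h :=
  ((contMDiff_mul_right (I := 𝓡 n) (n := ∞) (a := g)).contMDiffAt).mdifferentiableAt (by simp)

theorem isManifold_one : IsManifold (𝓡 n) 1 G := IsManifold.of_le (n := ∞) (by simp)

theorem contDiffAt_chartMul : ContDiffAt ℝ ∞ (chartMul n G)
    (extChartAt (𝓡 n) (1 : G) 1, extChartAt (𝓡 n) (1 : G) 1) := by
  have h := (contMDiff_mul (𝓡 n) ∞ (G := G)).contMDiffAt (x := ((1 : G), (1 : G)))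
  rw [contMDiffAt_iff] at h
  have h2 := h.2
  simp only [mul_one, ModelWithCorners.range_eq_univ] at h2
  exact contDiffWithinAt_univ.1 h2

theorem hasFDerivAt_chartMul_left {a : EuclideanSpace ℝ (Fin n)}
    (ha : a ∈ (extChartAt (𝓡 n) (1 : G)).target) :
    HasFDerivAt (fun b => chartMul n G (a, b))
      ((chartDeriv n 1 ((extChartAt (𝓡 n) (1 : G)).symm a)).comp
        (modelDeriv n (fun x : G => (extChartAt (𝓡 n) (1 : G)).symm a * x) 1))
      (extChartAt (𝓡 n) (1 : G) 1) := by
  have := isManifold_one (n := n) (G := G)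
  exact hasFDerivAt_chart_conj (mdifferentiableAt_mul_left _ _) (mul_one _)
    (by simpa using (extChartAt (𝓡 n) (1 : G)).map_target ha)

theorem hasFDerivAt_chartMul_right {a : EuclideanSpace ℝ (Fin n)}
    (ha : a ∈ (extChartAt (𝓡 n) (1 : G)).target) :
    HasFDerivAt (fun b => chartMul n G (b, a))
      ((chartDeriv n 1 ((extChartAt (𝓡 n) (1 : G)).symm a)).comp
        (modelDeriv n (fun x : G => x * (extChartAt (𝓡 n) (1 : G)).symm a) 1))
      (extChartAt (𝓡 n) (1 : G) 1) := by
  have := isManifold_one (n := n) (G := G)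
  exact hasFDerivAt_chart_conj (mdifferentiableAt_mul_right _ _) (one_mul _)
    (by simpa using (extChartAt (𝓡 n) (1 : G)).map_target ha)

/-- The bracket of the Lie algebra of `G`, computed in the chart at the unit. -/
theorem bracket_eq_lieBracket_chartMul (u w : GroupLieAlgebra (𝓡 n) G) :
    ⁅u, w⁆ = VectorField.lieBracket (E := EuclideanSpace ℝ (Fin n)) ℝ
      (fun a => fderiv ℝ (fun b => chartMul n G (a, b)) (extChartAt (𝓡 n) (1 : G) 1) u)
      (fun a => fderiv ℝ (fun b => chartMul n G (a, b)) (extChartAt (𝓡 n) (1 : G) 1) w)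
      (extChartAt (𝓡 n) (1 : G) 1) := by
  have := isManifold_one (n := n) (G := G)
  -- Read in the chart, the left-invariant field of `v` is the partial derivative of the
  -- multiplication in its second variable.
  have key : ∀ v : GroupLieAlgebra (𝓡 n) G,
      VectorField.mpullbackWithin 𝓘(ℝ, EuclideanSpace ℝ (Fin n)) (𝓡 n)
        (extChartAt (𝓡 n) (1 : G)).symm (mulInvariantVectorField v) (range (𝓡 n))
      =ᶠ[𝓝 (extChartAt (𝓡 n) (1 : G) 1)]
      fun a => fderiv ℝ (fun b => chartMul n G (a, b)) (extChartAt (𝓡 n) (1 : G) 1) v := by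
    intro v
    filter_upwards [extChartAt_target_mem_nhds (I := 𝓡 n) (1 : G)] with a ha
    rw [(hasFDerivAt_chartMul_left ha).fderiv]
    exact DFunLike.congr_fun (mfderivWithin_extChartAt_symm_inverse (1 : G) ha) _
  -- The outer factor in the manifold bracket is trivial: the chart has derivative id at its centre,
  -- and without boundary the bracket within the range is the full one.
  have hb : ∀ v w : EuclideanSpace ℝ (Fin n) → EuclideanSpace ℝ (Fin n),
      (mfderiv (𝓡 n) 𝓘(ℝ, EuclideanSpace ℝ (Fin n)) (extChartAt (𝓡 n) (1 : G)) 1).inverse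
        (VectorField.lieBracketWithin ℝ v w ((extChartAt (𝓡 n) (1 : G)).symm ⁻¹' univ ∩
          range (𝓡 n)) (extChartAt (𝓡 n) (1 : G) 1)) =
      VectorField.lieBracket ℝ v w (extChartAt (𝓡 n) (1 : G) 1) := by
    intro v w
    have h₁ : VectorField.lieBracketWithin (E := EuclideanSpace ℝ (Fin n)) ℝ v w
        ((extChartAt (𝓡 n) (1 : G)).symm ⁻¹' univ ∩ range (𝓡 n)) (extChartAt (𝓡 n) (1 : G) 1) =
        VectorField.lieBracket ℝ v w (extChartAt (𝓡 n) (1 : G) 1) := by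
      rw [ModelWithCorners.range_eq_univ, preimage_univ, univ_inter,
        VectorField.lieBracketWithin_univ]
    have h₂ : (chartDeriv n (1 : G) 1).inverse = ContinuousLinearMap.id ℝ _ := by
      rw [chartDeriv_self, ContinuousLinearMap.inverse_id]
    exact (DFunLike.congr_fun h₂ _).trans h₁
  refine (hb _ _).trans ?_
  have := (Filter.EventuallyEq.lieBracket_vectorField_eq (𝕜 := ℝ) (key u) (key w))
  exact this

/-- The adjoint action on `w`, as a map to the model space. -/
def adVec (w : EuclideanSpace ℝ (Fin n)) (g : G) : EuclideanSpace ℝ (Fin n) :=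
  modelDeriv n (fun x : G => g * x * g⁻¹) 1 w

theorem contMDiff_adVec (w : EuclideanSpace ℝ (Fin n)) :
    ContMDiff (𝓡 n) 𝓘(ℝ, EuclideanSpace ℝ (Fin n)) ∞ (adVec w : G → EuclideanSpace ℝ (Fin n)) :=
  contMDiff_Ad.clm_apply contMDiff_const

theorem adVec_mul (w : EuclideanSpace ℝ (Fin n)) (g h : G) :
    adVec w (g * h) = modelDeriv n (fun x : G => g * x * g⁻¹) 1 (adVec w h) := by
  have := isManifold_one (n := n) (G := G)
  rw [adVec, adVec, ← modelDeriv_comp (mdifferentiableAt_conj h 1) (mdifferentiableAt_conj g 1)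
    (by simp)]
  simp [mul_assoc]

/-- From (gxg⁻¹)g = gx. This is the intertwining hypothesis of `fderiv_eq_lieBracket_of_partial`. -/
theorem modelDeriv_mul_right_adVec (w : EuclideanSpace ℝ (Fin n)) (g : G) :
    modelDeriv n (fun x : G => x * g) 1 (adVec w g) = modelDeriv n (fun x : G => g * x) 1 w := by
  have := isManifold_one (n := n) (G := G)
  rw [adVec, ← modelDeriv_comp (mdifferentiableAt_conj g 1) (mdifferentiableAt_mul_right g 1)
    (by simp)]
  simp [mul_assoc]

theorem adVec_one (w : EuclideanSpace ℝ (Fin n)) : adVec w (1 : G) = w := by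
  have := isManifold_one (n := n) (G := G)
  simp only [adVec, one_mul, inv_one, mul_one]
  exact DFunLike.congr_fun (mfderiv_id (I := 𝓡 n) (x := (1 : G))) w

/-- The bracket of the Lie algebra of `G`, on the model space. -/
def modelBracket (n : ℕ) (G : Type u) [TopologicalSpace G]
    [ChartedSpace (EuclideanSpace ℝ (Fin n)) G] [Group G] (u w : GroupLieAlgebra (𝓡 n) G) :
    EuclideanSpace ℝ (Fin n) :=
  (⁅u, w⁆ : GroupLieAlgebra (𝓡 n) G)

theorem mdifferentiableAt_adVec (w : EuclideanSpace ℝ (Fin n)) (g : G) :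
    MDifferentiableAt (𝓡 n) (𝓡 n) (adVec w : G → EuclideanSpace ℝ (Fin n)) g :=
  (contMDiff_adVec (G := G) w).contMDiffAt.mdifferentiableAt (by simp)

/-- The classical d(Ad)_e = ad: `fderiv_eq_lieBracket_of_partial` is applied to the multiplication
in the chart at e and to g ↦ Ad g w. -/
theorem modelDeriv_adVec_one (u w : EuclideanSpace ℝ (Fin n)) :
    modelDeriv n (adVec w : G → EuclideanSpace ℝ (Fin n)) 1 u =
      modelBracket n G u w := by
  have := isManifold_one (n := n) (G := G)
  have hd' : HasFDerivWithinAt (fun a => adVec w ((extChartAt (𝓡 n) (1 : G)).symm a))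
      (modelDeriv n (adVec w : G → EuclideanSpace ℝ (Fin n)) 1) (range (𝓡 n))
      (extChartAt (𝓡 n) (1 : G) 1) := (mdifferentiableAt_adVec w 1).hasMFDerivAt.2
  rw [ModelWithCorners.range_eq_univ, hasFDerivWithinAt_univ] at hd'
  have hc : chartDeriv n (1 : G) 1 = ContinuousLinearMap.id ℝ _ := chartDeriv_self 1
  have hid : modelDeriv n (fun x : G => x) 1 = ContinuousLinearMap.id ℝ _ :=
    mfderiv_id (I := 𝓡 n) (x := (1 : G))
  have h0 := mem_extChartAt_target (I := 𝓡 n) (1 : G)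
  have key := fderiv_eq_lieBracket_of_partial (E := EuclideanSpace ℝ (Fin n)) (u := u) (w := w)
    ((contDiffAt_chartMul (n := n) (G := G)).of_le ENat.LEInfty.out)
    (by
      rw [(hasFDerivAt_chartMul_right h0).fderiv]
      simp only [extChartAt_to_inv, mul_one, hc, hid, ContinuousLinearMap.comp_id])
    (by
      rw [(hasFDerivAt_chartMul_left h0).fderiv]
      simp only [extChartAt_to_inv, one_mul, hc, hid, ContinuousLinearMap.comp_id])
    hd'.differentiableAt
    ((congrArg (adVec w) (extChartAt_to_inv (I := 𝓡 n) (1 : G))).trans (adVec_one w))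
    (by
      filter_upwards [extChartAt_target_mem_nhds (I := 𝓡 n) (1 : G)] with a ha
      rw [(hasFDerivAt_chartMul_left ha).fderiv, (hasFDerivAt_chartMul_right ha).fderiv]
      exact congrArg _ (modelDeriv_mul_right_adVec w _))
  rw [hd'.fderiv] at key
  exact key.trans (bracket_eq_lieBracket_chartMul (G := G) u w).symm

/-- The derivative of the adjoint representation along a left-invariant vector field. -/
theorem modelDeriv_adVec (g : G) (u w : EuclideanSpace ℝ (Fin n)) :
    modelDeriv n (adVec w : G → EuclideanSpace ℝ (Fin n)) g (dl g u) =
      Ad g (modelBracket n G u w) := by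
  -- The map h ↦ Ad(gh) w is differentiated at e in two ways: through l_g, and as the linear map Ad
  -- g after h ↦ Ad h w.
  have h₁ := modelDeriv_comp (H := (adVec w : G → EuclideanSpace ℝ (Fin n)))
    (mdifferentiableAt_mul_left g 1) (mdifferentiableAt_adVec w g) (mul_one g) u
  simp only [adVec_mul] at h₁
  have hL : HasMFDerivAt (𝓡 n) (𝓡 n) (modelDeriv n (fun x : G => g * x * g⁻¹) 1)
      (adVec w (1 : G)) (modelDeriv n (fun x : G => g * x * g⁻¹) 1) :=
    (modelDeriv n (fun x : G => g * x * g⁻¹) 1).hasMFDerivAt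
  have h₂ := modelDeriv_comp (H := modelDeriv n (fun x : G => g * x * g⁻¹) 1)
    (mdifferentiableAt_adVec w (1 : G)) hL.mdifferentiableAt rfl u
  rw [h₁, modelDeriv_adVec_one] at h₂
  exact h₂.trans (DFunLike.congr_fun hL.mfderiv _)

end adjoint

/-! ### Functions with zero derivative on a connected manifold -/

section constancy

variable {n : ℕ} {N : Type*} [TopologicalSpace N] [ChartedSpace (EuclideanSpace ℝ (Fin n)) N]
  [IsManifold (𝓡 n) 1 N] {F : Type*} [NormedAddCommGroup F] [NormedSpace ℝ F]

/-- A function with vanishing derivative on a connected manifold is constant. -/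
theorem apply_eq_of_mfderiv_eq_zero [PreconnectedSpace N] {f : N → F}
    (hf : MDifferentiable (𝓡 n) 𝓘(ℝ, F) f)
    (h : ∀ x v, mfderiv (𝓡 n) 𝓘(ℝ, F) f x v = 0) (x y : N) : f x = f y := by
  refine IsLocallyConstant.apply_eq_of_preconnectedSpace ?_ x y
  rw [IsLocallyConstant.iff_eventually_eq]
  intro z
  set φ := extChartAt (𝓡 n) z with hφ
  -- A ball inside the chart target is connected, so the Euclidean statement applies on it.
  obtain ⟨r, hr, hball⟩ := Metric.mem_nhds_iff.1 (extChartAt_target_mem_nhds (I := 𝓡 n) z)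
  have hd : ∀ a ∈ Metric.ball (φ z) r, HasFDerivAt (f ∘ φ.symm) (0 : _ →L[ℝ] F) a := by
    intro a ha
    have hs : MDifferentiableAt 𝓘(ℝ, EuclideanSpace ℝ (Fin n)) (𝓡 n) φ.symm a :=
      (mdifferentiableOn_extChartAt_symm a (hball ha)).mdifferentiableAt
        ((isOpen_extChartAt_target z).mem_nhds (hball ha))
    have hc := ((hf (φ.symm a)).hasMFDerivAt.comp a hs.hasMFDerivAt).hasFDerivAt
    have h0 : (mfderiv (𝓡 n) 𝓘(ℝ, F) f (φ.symm a)) = 0 := ContinuousLinearMap.ext (h _)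
    rw [h0, ContinuousLinearMap.zero_comp] at hc
    exact hc
  have hφz : ∀ᶠ w in 𝓝 z, φ w ∈ Metric.ball (φ z) r ∧ w ∈ φ.source :=
    ((continuousAt_extChartAt z).eventually (Metric.ball_mem_nhds _ hr)).and
      (extChartAt_source_mem_nhds z)
  filter_upwards [hφz] with w hw
  have := Metric.isOpen_ball.is_const_of_fderiv_eq_zero (𝕜 := ℝ)
    (convex_ball (φ z) r).isPreconnected
    (fun a ha => (hd a ha).differentiableAt.differentiableWithinAt)
    (fun a ha => (hd a ha).fderiv) hw.1 (Metric.mem_ball_self hr)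
  rwa [Function.comp_apply, Function.comp_apply, φ.left_inv hw.2, hφ, extChartAt_to_inv] at this

end constancy

/-! ### Product rule for the pairing of covectors and vectors -/

section product

variable {E : Type*} [NormedAddCommGroup E] [NormedSpace ℝ E] {H : Type*} [TopologicalSpace H]
  {I : ModelWithCorners ℝ E H} {M : Type*} [TopologicalSpace M] [ChartedSpace H M]
  {F : Type*} [NormedAddCommGroup F] [NormedSpace ℝ F]

theorem mfderiv_clm_apply_apply {L : M → F →L[ℝ] ℝ} {v : M → F} {x : M}
    (hL : MDifferentiableAt I 𝓘(ℝ, F →L[ℝ] ℝ) L x) (hv : MDifferentiableAt I 𝓘(ℝ, F) v x)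
    (t : TangentSpace I x) :
    mfderiv I 𝓘(ℝ, ℝ) (fun y => L y (v y)) x t =
      (show F →L[ℝ] ℝ from mfderiv I 𝓘(ℝ, F →L[ℝ] ℝ) L x t) (v x) +
        L x (mfderiv I 𝓘(ℝ, F) v x t) := by
  have hL' : HasFDerivWithinAt (fun a => L ((extChartAt I x).symm a))
      (show E →L[ℝ] F →L[ℝ] ℝ from mfderiv I 𝓘(ℝ, F →L[ℝ] ℝ) L x) (range I) (extChartAt I x x) :=
    hL.hasMFDerivAt.2
  have hv' : HasFDerivWithinAt (fun a => v ((extChartAt I x).symm a))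
      (show E →L[ℝ] F from mfderiv I 𝓘(ℝ, F) v x) (range I) (extChartAt I x x) :=
    hv.hasMFDerivAt.2
  have h := hL'.clm_apply hv'
  rw [extChartAt_to_inv] at h
  have h' : HasMFDerivAt I 𝓘(ℝ, ℝ) (fun y => L y (v y)) x _ :=
    ⟨hL.continuousAt.clm_apply hv.continuousAt, h⟩
  exact (DFunLike.congr_fun h'.mfderiv t).trans (add_comm _ _)

end product

/-! ### The moment map and its level sets -/

section moment

variable {n : ℕ} {G : Type u} [TopologicalSpace G] [ChartedSpace (EuclideanSpace ℝ (Fin n)) G]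
  [Group G] [LieGroup (𝓡 n) ∞ G]

theorem coAd_apply (g : G) (ξ : CotangentSpace n (1 : G)) (v : EuclideanSpace ℝ (Fin n)) :
    coAd g ξ v = ξ (adVec v g⁻¹) := rfl

theorem coAd_symm_apply (g : G) (ξ : CotangentSpace n (1 : G)) (v : EuclideanSpace ℝ (Fin n)) :
    (coAd g).symm ξ v = ξ (adVec v g) := rfl

theorem coAd_symm (g : G) (ξ : CotangentSpace n (1 : G)) : (coAd g).symm ξ = coAd g⁻¹ ξ :=
  ContinuousLinearMap.ext fun v => by
    refine (coAd_symm_apply g ξ v).trans (Eq.trans ?_ (coAd_apply g⁻¹ ξ v).symm)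
    rw [inv_inv]

theorem coAd_mul (g h : G) (ξ : CotangentSpace n (1 : G)) :
    coAd (g * h) ξ = coAd g (coAd h ξ) :=
  ContinuousLinearMap.ext fun v => by
    have h' : adVec v (g * h)⁻¹ = modelDeriv n (fun x : G => h⁻¹ * x * h⁻¹⁻¹) 1 (adVec v g⁻¹) := by
      rw [mul_inv_rev]
      exact adVec_mul v _ _
    exact congrArg ξ h'

theorem toDual_leftForm (g : G) (ξ : CotangentSpace n (1 : G)) :
    toDual (⟨g, leftForm g ξ⟩ : Cotangent n G) = ξ :=
  ContinuousLinearMap.ext fun v => congrArg ξ ((dl (n := n) g).symm_apply_apply v)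

theorem leftForm_toDual (p : Cotangent n G) : leftForm p.1 (toDual p) = p.2 :=
  ContinuousLinearMap.ext fun v => congrArg p.2 ((dl (n := n) p.1).apply_symm_apply v)

/-- The moment map of the lifted left action of `G` on `T^* G`. -/
def momentMap (p : Cotangent n G) : EuclideanSpace ℝ (Fin n) →L[ℝ] ℝ :=
  coAd p.1 (toDual p)

theorem toDual_coadjointSection (ξ : CotangentSpace n (1 : G)) (g : G) :
    toDual (toBundle (coadjointSection ξ) g) = (coAd g).symm ξ :=
  toDual_leftForm g _

theorem momentMap_coadjointSection (ξ : CotangentSpace n (1 : G)) (g : G) :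
    momentMap (toBundle (coadjointSection ξ) g) = ξ :=
  (congrArg (coAd g) (toDual_coadjointSection ξ g)).trans ((coAd g).apply_symm_apply ξ)

theorem coadjointSection_momentMap (p : Cotangent n G) :
    toBundle (coadjointSection (G := G) (momentMap p)) p.1 = p := by
  obtain ⟨g, η⟩ := p
  have h : (coAd g).symm (momentMap ⟨g, η⟩) = toDual ⟨g, η⟩ := (coAd g).symm_apply_apply _
  simp only [toBundle, coadjointSection, h]
  exact congrArg _ (leftForm_toDual ⟨g, η⟩)

/-- A covector is recovered from its base point and its moment, so a level set of the moment map is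
the graph of one section. -/
theorem range_coadjointSection (ξ : CotangentSpace n (1 : G)) :
    range (toBundle (coadjointSection ξ)) = {p : Cotangent n G | momentMap p = ξ} := by
  ext p
  constructor
  · rintro ⟨g, rfl⟩
    exact momentMap_coadjointSection ξ g
  · rintro rfl
    exact ⟨p.1, coadjointSection_momentMap p⟩

theorem contMDiff_momentMap : ContMDiff (cotangentModel n)
    𝓘(ℝ, EuclideanSpace ℝ (Fin n) →L[ℝ] ℝ) ∞ (momentMap : Cotangent n G → _) :=
  contMDiff_toDual.clm_comp (contMDiff_Ad.comp
    ((contMDiff_inv (𝓡 n) ∞).comp (contMDiff_proj (fun g : G => CotangentSpace n g))))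

/-- The diffeomorphism `(g, ξ) ↦ (Ad^* g)⁻¹ ξ ∈ T_g^* G`. -/
def coadjointDiffeomorph : Diffeomorph ((𝓡 n).prod 𝓘(ℝ, EuclideanSpace ℝ (Fin n) →L[ℝ] ℝ))
    (cotangentModel n) (G × (EuclideanSpace ℝ (Fin n) →L[ℝ] ℝ)) (Cotangent n G) ∞ where
  toFun q := toBundle (coadjointSection q.2) q.1
  invFun p := (p.1, momentMap p)
  left_inv q := Prod.ext rfl (momentMap_coadjointSection q.2 q.1)
  right_inv p := coadjointSection_momentMap p
  contMDiff_toFun := contMDiff_leftForm.comp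
    (contMDiff_fst.prodMk (contMDiff_snd.clm_comp (contMDiff_Ad.comp contMDiff_fst)))
  contMDiff_invFun :=
    (contMDiff_proj (fun g : G => CotangentSpace n g)).prodMk contMDiff_momentMap

theorem contMDiff_coadjointSection (ξ : CotangentSpace n (1 : G)) :
    ContMDiff (𝓡 n) (cotangentModel n) ∞ (toBundle (coadjointSection ξ)) :=
  (coadjointDiffeomorph (n := n) (G := G)).contMDiff.comp
    (contMDiff_id.prodMk (contMDiff_const (M' := EuclideanSpace ℝ (Fin n) →L[ℝ] ℝ) (c := ξ)))

theorem mdifferentiableAt_momentMap (p : Cotangent n G) : MDifferentiableAt (cotangentModel n)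
    𝓘(ℝ, EuclideanSpace ℝ (Fin n) →L[ℝ] ℝ) momentMap p :=
  contMDiff_momentMap.contMDiffAt.mdifferentiableAt (by simp)

theorem mdifferentiableAt_proj (p : Cotangent n G) : MDifferentiableAt (cotangentModel n)
    (𝓡 n) (fun q : Cotangent n G => q.1) p :=
  (contMDiff_proj (n := ∞) (fun g : G => CotangentSpace n g)).contMDiffAt.mdifferentiableAt
    (by simp)

theorem mdifferentiableAt_toDual_apply (w : GroupLieAlgebra (𝓡 n) G) (p : Cotangent n G) :
    MDifferentiableAt (cotangentModel n) 𝓘(ℝ, ℝ) (fun q : Cotangent n G => toDual q w) p :=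
  (contMDiff_toDual.clm_apply (contMDiff_const (M' := EuclideanSpace ℝ (Fin n)) (c := w))
    ).contMDiffAt.mdifferentiableAt (n := ∞) (by simp)

end moment

/-! ### Solutions, leaves and invariance -/

section foliation

variable {n : ℕ} {G : Type u} [TopologicalSpace G] [ChartedSpace (EuclideanSpace ℝ (Fin n)) G]
  [Group G] [LieGroup (𝓡 n) ∞ G]

/-- The moment map is constant along the invariant Hamiltonian vector fields. -/
theorem mfderiv_momentMap_eq_zero {p : Cotangent n G} {Λ : TangentSpace (cotangentModel n) p}
    (hΛ : Λ ∈ hamiltonianDistribution p) :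
    mfderiv (cotangentModel n) 𝓘(ℝ, EuclideanSpace ℝ (Fin n) →L[ℝ] ℝ) momentMap p Λ = 0 := by
  obtain ⟨u, hu, hw⟩ := hΛ
  refine ContinuousLinearMap.ext (M₁ := EuclideanSpace ℝ (Fin n)) fun v => ?_
  -- The vector `w` is frozen at the base point of `p`, so that J(q)(Ad w), with Ad taken at the
  -- base point of q, is the left reading of q at `w` for every q, while at `p` the argument of J is
  -- `v`.
  set w : GroupLieAlgebra (𝓡 n) G := (Ad p.1).symm v with hwv
  have hv : adVec w p.1 = v := (Ad (n := n) p.1).apply_symm_apply v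
  have hadV : MDifferentiableAt (cotangentModel n) 𝓘(ℝ, EuclideanSpace ℝ (Fin n))
      (fun q : Cotangent n G => adVec w q.1) p :=
    (mdifferentiableAt_adVec w p.1).comp p (mdifferentiableAt_proj p)
  have hmul : ∀ q : Cotangent n G, momentMap q (adVec w q.1) = toDual q w := fun q =>
    congrArg (toDual q) ((Ad (n := n) q.1).symm_apply_apply w)
  have h := mfderiv_clm_apply_apply (mdifferentiableAt_momentMap p) hadV Λ
  have hd : mfderiv (cotangentModel n) 𝓘(ℝ, EuclideanSpace ℝ (Fin n))
      (fun q : Cotangent n G => adVec w q.1) p Λ = Ad p.1 (modelBracket n G u w) := by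
    have hc := mfderiv_comp p (mdifferentiableAt_adVec w p.1) (mdifferentiableAt_proj p)
    refine (DFunLike.congr_fun hc Λ).trans ?_
    refine (congrArg (modelDeriv n (adVec w : G → EuclideanSpace ℝ (Fin n)) p.1) hu).trans ?_
    exact modelDeriv_adVec p.1 u w
  have h₁ : momentMap p (Ad p.1 (modelBracket n G u w)) = toDual p ⁅u, w⁆ :=
    congrArg (toDual p) ((Ad (n := n) p.1).symm_apply_apply _)
  have hfun : (fun q : Cotangent n G => momentMap q (adVec w q.1)) = fun q => toDual q w :=
    funext hmul
  rw [hd, hv, hfun] at h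
  -- The product rule reads ξ([u,w]) = (dJ Λ)(v) + J(p)(Ad [u,w]); by `h₁` the last term equals the
  -- left side, so (dJ Λ)(v) = 0.
  have h₂ := (hw w).symm.trans h
  rw [h₁] at h₂
  exact left_eq_add.1 ((h₂.trans (add_comm _ _)))

/-- A tangent vector of `T^* G` is determined by its images under the projection and the moment
map. -/
theorem eq_of_mfderiv_momentMap_eq {p : Cotangent n G} {Λ Λ' : TangentSpace (cotangentModel n) p}
    (h₁ : mfderiv (cotangentModel n) (𝓡 n) (fun q : Cotangent n G => q.1) p Λ =
      mfderiv (cotangentModel n) (𝓡 n) (fun q : Cotangent n G => q.1) p Λ')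
    (h₂ : mfderiv (cotangentModel n) 𝓘(ℝ, EuclideanSpace ℝ (Fin n) →L[ℝ] ℝ) momentMap p Λ =
      mfderiv (cotangentModel n) 𝓘(ℝ, EuclideanSpace ℝ (Fin n) →L[ℝ] ℝ) momentMap p Λ') :
    Λ = Λ' := by
  -- The pair (projection, J) has the smooth left inverse `coadjointDiffeomorph`, hence an injective
  -- derivative.
  have hprod := mfderiv_prodMk (mdifferentiableAt_proj p) (mdifferentiableAt_momentMap p)
  have hD := ((coadjointDiffeomorph (n := n) (G := G)).contMDiff.mdifferentiable (by simp))
    (p.1, momentMap p)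
  have hc := mfderiv_comp p hD
    ((mdifferentiableAt_proj p).prodMk (mdifferentiableAt_momentMap p))
  have hid : (coadjointDiffeomorph (n := n) (G := G)) ∘ (fun q => (q.1, momentMap q)) = id :=
    funext coadjointSection_momentMap
  rw [hid, mfderiv_id] at hc
  have key : mfderiv (cotangentModel n) ((𝓡 n).prod 𝓘(ℝ, EuclideanSpace ℝ (Fin n) →L[ℝ] ℝ))
      (fun q : Cotangent n G => (q.1, momentMap q)) p Λ =
      mfderiv (cotangentModel n) ((𝓡 n).prod 𝓘(ℝ, EuclideanSpace ℝ (Fin n) →L[ℝ] ℝ))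
      (fun q : Cotangent n G => (q.1, momentMap q)) p Λ' := by
    rw [hprod]
    exact Prod.ext h₁ h₂
  exact (DFunLike.congr_fun hc Λ).trans
    ((congrArg _ key).trans (DFunLike.congr_fun hc Λ').symm)

/-- The moment map is constant on maps tangent to the distribution of invariant Hamiltonian
vector fields. -/
theorem momentMap_apply_eq {N : Type*} [TopologicalSpace N]
    [ChartedSpace (EuclideanSpace ℝ (Fin n)) N] [IsManifold (𝓡 n) 1 N] [PreconnectedSpace N]
    {f : N → Cotangent n G} (hf : MDifferentiable (𝓡 n) (cotangentModel n) f)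
    (h : ∀ x v, mfderiv (𝓡 n) (cotangentModel n) f x v ∈ hamiltonianDistribution (f x))
    (x y : N) : momentMap (f x) = momentMap (f y) := by
  refine apply_eq_of_mfderiv_eq_zero (f := momentMap ∘ f)
    (fun z => (mdifferentiableAt_momentMap (f z)).comp z (hf z)) (fun z v => ?_) x y
  have hc := mfderiv_comp z (mdifferentiableAt_momentMap (f z)) (hf z)
  exact (DFunLike.congr_fun hc v).trans (mfderiv_momentMap_eq_zero (h z v))

theorem mfderiv_proj_toBundle {σ : ∀ g : G, CotangentSpace n g} {g : G}
    (hσ : MDifferentiableAt (𝓡 n) (cotangentModel n) (toBundle σ) g) (v : TangentSpace (𝓡 n) g) :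
    mfderiv (cotangentModel n) (𝓡 n) (fun q : Cotangent n G => q.1) (toBundle σ g)
      (mfderiv (𝓡 n) (cotangentModel n) (toBundle σ) g v) = v := by
  have hc := mfderiv_comp g (mdifferentiableAt_proj (toBundle σ g)) hσ
  have hid : (fun q : Cotangent n G => q.1) ∘ toBundle σ = id := rfl
  rw [hid, mfderiv_id] at hc
  exact (DFunLike.congr_fun hc v).symm

/-- The derivative of a solution takes left-invariant vector fields to invariant Hamiltonian
vector fields. -/
theorem IsSolution.isHamiltonianVector {σ : ∀ g : G, CotangentSpace n g} (hσ : IsSolution σ)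
    (g : G) (u : GroupLieAlgebra (𝓡 n) G) :
    IsHamiltonianVector u (toBundle σ g)
      (mfderiv (𝓡 n) (cotangentModel n) (toBundle σ) g (dl g u)) := by
  refine ⟨mfderiv_proj_toBundle (hσ.1 g) _, fun w => ?_⟩
  have hc := mfderiv_comp g (mdifferentiableAt_toDual_apply w (toBundle σ g)) (hσ.1 g)
  exact (DFunLike.congr_fun hc (dl g u)).symm.trans (hσ.2 g u w)

theorem IsSolution.mfderiv_mem {σ : ∀ g : G, CotangentSpace n g} (hσ : IsSolution σ)
    (g : G) (v : TangentSpace (𝓡 n) g) :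
    mfderiv (𝓡 n) (cotangentModel n) (toBundle σ) g v ∈
      hamiltonianDistribution (toBundle σ g) := by
  refine ⟨(dl g).symm v, ?_⟩
  have h := hσ.isHamiltonianVector g ((dl g).symm v)
  rwa [(dl g).apply_symm_apply v] at h

/-- Read on the left, the section pairs with w to ξ(Ad g w), whose derivative along dl_g u is ξ(Ad g
[u, w]). -/
theorem isSolution_coadjointSection (ξ : CotangentSpace n (1 : G)) :
    IsSolution (coadjointSection ξ) := by
  refine ⟨(contMDiff_coadjointSection ξ).mdifferentiable (by simp), fun g u w => ?_⟩
  have hL : HasMFDerivAt (𝓡 n) 𝓘(ℝ, ℝ) (show EuclideanSpace ℝ (Fin n) →L[ℝ] ℝ from ξ) (adVec w g)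
      (show EuclideanSpace ℝ (Fin n) →L[ℝ] ℝ from ξ) :=
    ContinuousLinearMap.hasMFDerivAt (show EuclideanSpace ℝ (Fin n) →L[ℝ] ℝ from ξ)
  have hfun : (fun x : G => toDual (toBundle (coadjointSection ξ) x) w) =
      (show EuclideanSpace ℝ (Fin n) →L[ℝ] ℝ from ξ) ∘ adVec w :=
    funext fun x => DFunLike.congr_fun (toDual_coadjointSection ξ x) w
  have hc := hL.comp g (mdifferentiableAt_adVec w g).hasMFDerivAt
  rw [hfun]
  refine (DFunLike.congr_fun hc.mfderiv (dl g u)).trans ?_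
  refine (congrArg ξ (modelDeriv_adVec g u w)).trans ?_
  exact (DFunLike.congr_fun (toDual_coadjointSection ξ g) ⁅u, w⁆).symm

theorem coadjointSection_one (ξ : CotangentSpace n (1 : G)) : coadjointSection ξ 1 = ξ := by
  have h₁ := toDual_coadjointSection ξ 1
  have h₂ : ∀ v : GroupLieAlgebra (𝓡 n) G, dl (1 : G) v = v := by
    intro v
    have h : modelDeriv n (fun x : G => 1 * x) 1 = ContinuousLinearMap.id ℝ _ := by
      simp only [one_mul]
      exact mfderiv_id
    exact DFunLike.congr_fun h v
  refine ContinuousLinearMap.ext fun v => ?_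
  have h₃ : coadjointSection ξ 1 (dl (1 : G) v) = ξ (adVec v (1 : G)) := DFunLike.congr_fun h₁ v
  rw [h₂] at h₃
  exact h₃.trans (congrArg ξ (adVec_one (G := G) v))

/-- J is constant along a solution because G is connected; its value at e is ξ, and J with the base
point determines the covector. -/
theorem IsSolution.eq_coadjointSection [PreconnectedSpace G] {ξ : CotangentSpace n (1 : G)}
    {σ : ∀ g : G, CotangentSpace n g} (hσ : IsSolution σ) (h : σ 1 = ξ) :
    σ = coadjointSection ξ := by
  have := isManifold_one (n := n) (G := G)
  have h₁ : toBundle σ 1 = toBundle (coadjointSection ξ) 1 := by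
    simp only [toBundle, h, coadjointSection_one]
  funext g
  have hg := momentMap_apply_eq hσ.1 hσ.mfderiv_mem g 1
  rw [h₁, momentMap_coadjointSection] at hg
  have hp := coadjointSection_momentMap (toBundle σ g)
  rw [hg] at hp
  exact (TotalSpace.mk_inj.1 hp).symm

theorem isIntegralManifold_range [ConnectedSpace G] (ξ : CotangentSpace n (1 : G)) :
    IsIntegralManifold (range (toBundle (coadjointSection ξ))) := by
  have hσ := isSolution_coadjointSection ξ
  refine ⟨G, inferInstance, inferInstance, toBundle (coadjointSection ξ), inferInstance,
    inferInstance, fun g h hgh => congrArg (fun q : Cotangent n G => q.1) hgh,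
    contMDiff_coadjointSection ξ, fun g v v' hv => ?_, fun g => ?_, rfl⟩
  · rw [← mfderiv_proj_toBundle (hσ.1 g) v, hv, mfderiv_proj_toBundle (hσ.1 g) v']
  · refine Subset.antisymm (range_subset_iff.2 (hσ.mfderiv_mem g)) ?_
    rintro Λ ⟨u, hu⟩
    have hu' := hσ.isHamiltonianVector g u
    -- Two Hamiltonian vectors at a point with the same u coincide: both project to dl_g u and both
    -- are killed by dJ.
    exact ⟨dl g u, eq_of_mfderiv_momentMap_eq (hu'.1.trans hu.1.symm)
      ((mfderiv_momentMap_eq_zero ⟨u, hu'⟩).trans (mfderiv_momentMap_eq_zero ⟨u, hu⟩).symm)⟩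

theorem IsIntegralManifold.momentMap_eq {L : Set (Cotangent n G)} (hL : IsIntegralManifold L)
    {p q : Cotangent n G} (hp : p ∈ L) (hq : q ∈ L) : momentMap p = momentMap q := by
  obtain ⟨N, _, _, f, hN, _, _, hf, _, hr, rfl⟩ := hL
  obtain ⟨x, rfl⟩ := hp
  obtain ⟨y, rfl⟩ := hq
  have : IsManifold (𝓡 n) 1 N := IsManifold.of_le (n := ∞) (by simp)
  exact momentMap_apply_eq (hf.mdifferentiable (by simp)) (fun x v => hr x ▸ mem_range_self v) x y

theorem IsIntegralManifold.nonempty {L : Set (Cotangent n G)} (hL : IsIntegralManifold L) :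
    L.Nonempty := by
  obtain ⟨N, _, _, f, _, _, _, _, _, _, rfl⟩ := hL
  exact range_nonempty f

theorem IsIntegralManifold.subset_range {L : Set (Cotangent n G)} (hL : IsIntegralManifold L)
    {p : Cotangent n G} (hp : p ∈ L) {ξ : CotangentSpace n (1 : G)} (h : momentMap p = ξ) :
    L ⊆ range (toBundle (coadjointSection ξ)) := by
  rw [range_coadjointSection]
  exact fun q hq => (hL.momentMap_eq hq hp).trans h

/-- Maximality: J is constant on a connected integral manifold, so one that meets a level set stays
inside it. -/
theorem isLeaf_range [ConnectedSpace G] (ξ : CotangentSpace n (1 : G)) :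
    IsLeaf (range (toBundle (coadjointSection ξ))) := by
  refine ⟨isIntegralManifold_range ξ, fun L' hL' ⟨p, hp, hp'⟩ => hL'.subset_range hp' ?_⟩
  rwa [range_coadjointSection] at hp

theorem IsLeaf.eq_range [ConnectedSpace G] {L : Set (Cotangent n G)} (hL : IsLeaf L)
    {p : Cotangent n G} (hp : p ∈ L) :
    L = range (toBundle (coadjointSection (G := G) (momentMap p))) :=
  Subset.antisymm (hL.1.subset_range hp rfl)
    (hL.2 _ (isIntegralManifold_range _) ⟨p, hp, p.1, coadjointSection_momentMap p⟩)

/-- The left reading is blind to left translations because l_{h⁻¹} ∘ l_{hg} = l_g. -/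
theorem toDual_leftLift (h : G) (p : Cotangent n G) : toDual (leftLift h p) = toDual p := by
  refine ContinuousLinearMap.ext fun v => ?_
  have hinv : (modelDeriv n (fun x : G => h * x) p.1).inverse =
      modelDeriv n (fun x : G => h⁻¹ * x) (h * p.1) := by
    refine ContinuousLinearMap.inverse_eq ?_ (mfderiv_mul_left_comp h p.1 _ rfl)
    have := mfderiv_mul_left_comp (n := n) h⁻¹ (h * p.1) p.1 (inv_mul_cancel_left h p.1)
    rwa [inv_inv] at this
  have hdl : modelDeriv n (fun x : G => h⁻¹ * x) (h * p.1)
      (modelDeriv n (fun x : G => h * p.1 * x) 1 v) = modelDeriv n (fun x : G => p.1 * x) 1 v := by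
    have hfun : (fun x : G => h⁻¹ * (h * p.1 * x)) = fun x => p.1 * x := by
      funext x
      rw [mul_assoc, inv_mul_cancel_left]
    rw [← hfun]
    exact (modelDeriv_comp (mdifferentiableAt_mul_left _ _) (mdifferentiableAt_mul_left _ _)
      (mul_one _) v).symm
  exact congrArg p.2 ((DFunLike.congr_fun hinv _).trans hdl)

theorem momentMap_leftLift (h : G) (p : Cotangent n G) :
    momentMap (leftLift h p) = coAd h (momentMap p) :=
  (congrArg (coAd (h * p.1)) (toDual_leftLift h p)).trans (coAd_mul h p.1 _)

/-- Both sides lie over hg and have moment Ad^*h ξ, which determines them. -/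
theorem leftLift_coadjointSection (h g : G) (ξ : CotangentSpace n (1 : G)) :
    leftLift h (toBundle (coadjointSection ξ) g) =
      toBundle (coadjointSection (coAd h ξ)) (h * g) := by
  have hm := momentMap_leftLift h (toBundle (coadjointSection ξ) g)
  have hp := coadjointSection_momentMap (leftLift h (toBundle (coadjointSection ξ) g))
  rw [hm, momentMap_coadjointSection] at hp
  exact hp.symm

end foliation

end LieCotangent

end

/-! ### The invariant foliation of T^*G -/

theorem mainTheorem2 {n : ℕ} {G : Type u} [TopologicalSpace G]
    [ChartedSpace (EuclideanSpace ℝ (Fin n)) G] [Group G] [LieGroup (𝓡 n) ∞ G]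
    [ConnectedSpace G] :
    -- the section is smooth and is the unique solution with initial value `ξ₀` at `e`
    (∀ ξ₀ : LieCotangent.CotangentSpace n (1 : G),
      ContMDiff (𝓡 n) (LieCotangent.cotangentModel n) ∞
        (LieCotangent.toBundle (LieCotangent.coadjointSection ξ₀)) ∧
      LieCotangent.coadjointSection ξ₀ 1 = ξ₀ ∧
      LieCotangent.IsSolution (LieCotangent.coadjointSection ξ₀) ∧
      ∀ σ : (∀ g : G, LieCotangent.CotangentSpace n g),
        LieCotangent.IsSolution σ → σ 1 = ξ₀ → σ = LieCotangent.coadjointSection ξ₀) ∧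
    -- the images of these sections foliate `T^* G`
    (∃ D : Diffeomorph ((𝓡 n).prod 𝓘(ℝ, EuclideanSpace ℝ (Fin n) →L[ℝ] ℝ))
        (LieCotangent.cotangentModel n) (G × (EuclideanSpace ℝ (Fin n) →L[ℝ] ℝ))
        (LieCotangent.Cotangent n G) ∞,
      ∀ (g : G) (ξ : LieCotangent.CotangentSpace n (1 : G)),
        D (g, ξ) = LieCotangent.toBundle (LieCotangent.coadjointSection ξ) g) ∧
    -- they are exactly the leaves, and each covector lies on exactly one of them
    (∀ L : Set (LieCotangent.Cotangent n G), LieCotangent.IsLeaf L ↔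
      ∃ ξ₀ : LieCotangent.CotangentSpace n (1 : G),
        L = Set.range (LieCotangent.toBundle (LieCotangent.coadjointSection ξ₀))) ∧
    (∀ p : LieCotangent.Cotangent n G,
      ∃! L : Set (LieCotangent.Cotangent n G), LieCotangent.IsLeaf L ∧ p ∈ L) ∧
    -- read in `𝔤^*` through left translation, the leaf through `ξ₀` is the coadjoint orbit of `ξ₀`
    (∀ ξ₀ : LieCotangent.CotangentSpace n (1 : G),
      LieCotangent.toDual ''
          Set.range (LieCotangent.toBundle (LieCotangent.coadjointSection ξ₀)) =
        LieCotangent.coadjointOrbit ξ₀) ∧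
    -- the foliation is invariant: `l_h` takes the leaf through `ξ₀` to the leaf through `Ad^* h ξ₀`
    (∀ (h : G) (ξ₀ : LieCotangent.CotangentSpace n (1 : G)),
      LieCotangent.leftLift h ''
          Set.range (LieCotangent.toBundle (LieCotangent.coadjointSection ξ₀)) =
        Set.range (LieCotangent.toBundle
          (LieCotangent.coadjointSection (LieCotangent.coAd h ξ₀)))) := by
  refine ⟨fun ξ => ⟨LieCotangent.contMDiff_coadjointSection ξ,
      LieCotangent.coadjointSection_one ξ, LieCotangent.isSolution_coadjointSection ξ,
      fun σ hσ h => hσ.eq_coadjointSection h⟩,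
    ⟨LieCotangent.coadjointDiffeomorph, fun g ξ => rfl⟩, fun L => ⟨fun hL => ?_, ?_⟩,
    fun p => ?_, fun ξ => ?_, fun h ξ => ?_⟩
  · obtain ⟨p, hp⟩ := hL.1.nonempty
    exact ⟨_, hL.eq_range hp⟩
  · rintro ⟨ξ, rfl⟩
    exact LieCotangent.isLeaf_range ξ
  · exact ⟨_, ⟨LieCotangent.isLeaf_range _, p.1, LieCotangent.coadjointSection_momentMap p⟩,
      fun L hL => hL.1.eq_range hL.2⟩
  · rw [← range_comp]
    ext η
    constructor
    · rintro ⟨g, rfl⟩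
      -- The leaf over g reads as (Ad^*g)⁻¹ ξ = Ad^*(g⁻¹) ξ, so the leaf and the orbit are matched
      -- by inversion.
      exact ⟨g⁻¹, ((LieCotangent.toDual_coadjointSection ξ g).trans
        (LieCotangent.coAd_symm g ξ)).symm⟩
    · rintro ⟨g, rfl⟩
      refine ⟨g⁻¹, (LieCotangent.toDual_coadjointSection ξ g⁻¹).trans
        ((LieCotangent.coAd_symm g⁻¹ ξ).trans ?_)⟩
      simp only [inv_inv]
  · rw [← range_comp]
    ext q
    constructor
    · rintro ⟨g, rfl⟩
      exact ⟨h * g, (LieCotangent.leftLift_coadjointSection h g ξ).symm⟩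
    · rintro ⟨g, rfl⟩
      refine ⟨h⁻¹ * g, (LieCotangent.leftLift_coadjointSection h _ ξ).trans ?_⟩
      rw [mul_inv_cancel_left]
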